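/- Let $Y_1,Y_2,\ldots$ be independent $\{0,1\}$-valued random variables with $p_\ell=\mathbb P(Y_\ell=1)\in(0,1)$, and suppose that $p_1,p_2,\ldots$ is periodic with period length $r\ge 1$ (the least positive integer with $p_\ell=p_{mr+\ell}$ for all $\ell,m$). Let $d\ge 3$ be an integer, $q=\lfloor (d-1)/2\rfloor$, $\omega_j=2\pi j/d$, and for $x\in\mathbb R^d$ put $$I_x(\omega_j)=\frac1d\Big|\sum_{\ell=1}^d x_\ell e^{-\mathrm i\ell\omega_j}\Big|^2,\qquad A=\{x\in\mathbb R^d: I_x(\omega_1)=\cdots=I_x(\omega_q)=0\},$$ $$g(x)=\frac{\max_{1\le j\le q}I_x(\omega_j)}{\sum_{m=1}^q I_x(\omega_m)}\quad(x\notin A),\qquad f(x)=g(x)\ \text{for } x\notin A,\quad f(x)=0\ \text{for } x\in A.$$ For $1\le i\le d$ let $$Z_i^n=\frac1{\lfloor n/d\rfloor}\sum_{k=0}^{\lfloor n/d\rfloor-1}Y_{i+kd},\qquad e_i=\frac1r\sum_{k=0}^{r-1}p_{i+kd},\qquad v_i=\frac1r\sum_{k=0}^{r-1}\operatorname{Var}(Y_{i+kd}).$$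 Let $N_1,\ldots,N_d$ be i.i.d. standard normal random variables. If $(e_1,\ldots,e_d)\in A$, then, as $n\to\infty$, $$f(Z_1^n,\ldots,Z_d^n)\ \xrightarrow{\ \mathcal L\ }\ g\big(\sqrt{v_1}\,N_1,\ldots,\sqrt{v_d}\,N_d\big)\ \overset{d}{=}\ g\Big(N_1,\sqrt{\tfrac{v_2}{v_1}}\,N_2,\ldots,\sqrt{\tfrac{v_d}{v_1}}\,N_d\Big),$$ where the arguments of $g$ in the two expressions on the right lie outside $A$ almost surely, so that these are well defined. -/

import Mathlib

open MeasureTheory ProbabilityTheory Filter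

noncomputable section

namespace BinaryPeriodicity

/-! Sequences and vectors are indexed from `0`: `Y k`, `p k` and `x i` stand for the mathematical
`Y_{k+1}`, `p_{k+1}` and `x_{i+1}`. Fourier frequencies keep their usual index `j = 1, …, q`. -/

/-- `r` is the period length of `p`: the least positive integer with `p_ℓ = p_{mr+ℓ}` for all
`ℓ, m`. -/
def IsPeriodLength (p : ℕ → ℝ) (r : ℕ) : Prop :=
  IsLeast {s : ℕ | 0 < s ∧ ∀ ℓ m : ℕ, p ℓ = p (m * s + ℓ)} r

/-- `q = ⌊(d-1)/2⌋`, the number of Fourier frequencies in use. -/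
def numFreq (d : ℕ) : ℕ := (d - 1) / 2

/-- The `j`-th Fourier frequency `ω_j = 2πj/d`. -/
def fourierFreq (d j : ℕ) : ℝ := 2 * Real.pi * j / d

/-- The periodogram `I_x(ω_j) = (1/d) |∑_{ℓ=1}^d x_ℓ exp(-iℓω_j)|²`. -/
def periodogram {d : ℕ} (x : Fin d → ℝ) (j : ℕ) : ℝ :=
  (1 / (d : ℝ)) *
    ‖∑ ℓ : Fin d, (x ℓ : ℂ) *
      Complex.exp (-Complex.I * ((ℓ : ℕ) + 1 : ℂ) * (fourierFreq d j : ℂ))‖ ^ 2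

/-- The set `A` on which all periodogram ordinates at `j = 1, …, q` vanish. -/
def zeroSet (d : ℕ) : Set (Fin d → ℝ) :=
  {x | ∀ j ∈ Finset.Icc 1 (numFreq d), periodogram x j = 0}

/-- Fisher's statistic `g(x) = max_{1≤j≤q} I_x(ω_j) / ∑_{m=1}^q I_x(ω_m)`, meaningful off `A`. -/
def fisherG {d : ℕ} (x : Fin d → ℝ) : ℝ :=
  (⨆ j : Finset.Icc 1 (numFreq d), periodogram x (j : ℕ)) /
    ∑ m ∈ Finset.Icc 1 (numFreq d), periodogram x m

/-- `f(x) = g(x) 1_{x ∉ A}`. -/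
def fisherF {d : ℕ} (x : Fin d → ℝ) : ℝ :=
  (zeroSet d)ᶜ.indicator fisherG x

/-- `Z_i^n = (1/⌊n/d⌋) ∑_{k=0}^{⌊n/d⌋-1} Y_{i+kd}`. -/
def blockMean {Ω : Type*} (Y : ℕ → Ω → ℝ) (d n : ℕ) (ω : Ω) (i : Fin d) : ℝ :=
  (1 / ((n / d : ℕ) : ℝ)) * ∑ k ∈ Finset.range (n / d), Y ((i : ℕ) + k * d) ω

/-- `e_i = (1/r) ∑_{k=0}^{r-1} p_{i+kd}`. -/
def limitMean (p : ℕ → ℝ) (r d : ℕ) (i : Fin d) : ℝ :=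
  (1 / (r : ℝ)) * ∑ k ∈ Finset.range r, p ((i : ℕ) + k * d)

/-- `v_i = (1/r) ∑_{j=0}^{r-1} Var(Y_{i+jd})`. -/
def limitVar {Ω : Type*} [MeasurableSpace Ω] (P : Measure Ω) (Y : ℕ → Ω → ℝ) (r d : ℕ)
    (i : Fin d) : ℝ :=
  (1 / (r : ℝ)) * ∑ j ∈ Finset.range r, variance (Y ((i : ℕ) + j * d)) P

end BinaryPeriodicity

end

open BinaryPeriodicity

open scoped Topology

/-! ### A central limit theorem for bounded independent summands -/

/-! Each periodogram ordinate is the squared modulus of a linear functional, up to a factor. Hence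
`fisherF` is invariant under translation by elements of `A` and under nonzero scaling. With `m = n /
d` and `e ∈ A`, the statistic of the block means equals that of `√m (Z - e)`
(`fisherF_blockMean_eq`).

That vector converges to `(√v_i N_i)`. Its coordinates are independent, since they use disjoint
residue classes mod `d`. Characteristic functions give the CLT: each of the `m` factors is within
`|t|³ m^(-3/2)` of a Gaussian one. Replacing the exact means by `e` costs `O(1/√m)`, because centred
partial sums of a periodic sequence are bounded.

`fisherF` is continuous off the closed set `A`. As `A` lies in a hyperplane whose equation involves
the first coordinate, the Gaussian limit avoids it almost surely, and the mapping theorem applies.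
The second form of the limit is a pointwise rescaling by `1/√v_1`. -/

theorem norm_exp_mul_I_sub_taylor_le {y : ℝ} (hy : |y| ≤ 1) :
    ‖Complex.exp (y * Complex.I) - (1 + y * Complex.I - ((y ^ 2 / 2 : ℝ) : ℂ))‖ ≤ |y| ^ 3 / 4 := by
  have hn : ‖(y * Complex.I : ℂ)‖ = |y| := by simp
  have h := Complex.exp_bound (x := y * Complex.I) (by rwa [hn]) (n := 3) (by norm_num)
  have hs : ∑ m ∈ Finset.range 3, (y * Complex.I : ℂ) ^ m / (m.factorial : ℂ)
      = 1 + y * Complex.I - ((y ^ 2 / 2 : ℝ) : ℂ) := by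
    simp [Finset.sum_range_succ, mul_pow, Nat.factorial]
    ring
  rw [hs, hn] at h
  refine h.trans ?_
  have : 0 ≤ |y| ^ 3 := by positivity
  -- The remainder constant is `4 / (3! * 3) = 2/9 ≤ 1/4`.
  norm_num [Nat.factorial]
  linarith

/-- Both terms are within `|s|³/4` of the quadratic `1 - v s²/2`: the first by Taylor expansion
under the integral, the second because `v ≤ 1` and `s⁴ ≤ |s|³`. -/
theorem norm_charFun_map_sub_exp_le {Ω : Type*} [MeasurableSpace Ω] {P : Measure Ω}
    [IsProbabilityMeasure P] {X : Ω → ℝ} (hX : Measurable X) (hb : ∀ ω, |X ω| ≤ 1)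
    (h0 : ∫ ω, X ω ∂P = 0) {s : ℝ} (hs : |s| ≤ 1) :
    ‖charFun (P.map X) s - ((Real.exp (-(∫ ω, X ω ^ 2 ∂P) * s ^ 2 / 2) : ℝ) : ℂ)‖ ≤ |s| ^ 3 := by
  set v := ∫ ω, X ω ^ 2 ∂P with hv
  have iX : Integrable X P :=
    Integrable.of_bound hX.aestronglyMeasurable 1 (ae_of_all _ (by simpa using hb))
  have hb2 : ∀ ω, X ω ^ 2 ≤ 1 := fun ω ↦ by rw [sq_le_one_iff_abs_le_one]; exact hb ω
  have iX2 : Integrable (fun ω ↦ X ω ^ 2) P :=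
    Integrable.of_bound (by fun_prop) 1 (ae_of_all _ fun ω ↦ by
      simpa using hb ω)
  have hv0 : 0 ≤ v := integral_nonneg fun ω ↦ sq_nonneg _
  have hv1 : v ≤ 1 := by
    calc v ≤ ∫ _, (1 : ℝ) ∂P := integral_mono iX2 (integrable_const _) hb2
      _ = 1 := by simp
  have hs2 : s ^ 2 ≤ 1 := by rwa [sq_le_one_iff_abs_le_one]
  have hs3 : s ^ 4 ≤ |s| ^ 3 := by
    have : s ^ 4 = |s| ^ 3 * |s| := by rw [← pow_succ, Even.pow_abs (by decide)]
    rw [this]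
    exact mul_le_of_le_one_right (by positivity) hs
  have hA : ‖charFun (P.map X) s - ((1 - v * s ^ 2 / 2 : ℝ) : ℂ)‖ ≤ |s| ^ 3 / 4 := by
    have e1 : charFun (P.map X) s = ∫ ω, Complex.exp ((s * X ω : ℝ) * Complex.I) ∂P := by
      rw [charFun_apply_real, integral_map hX.aemeasurable (by fun_prop)]
      simp
    have i1 : Integrable (fun ω ↦ Complex.exp ((s * X ω : ℝ) * Complex.I)) P :=
      Integrable.of_bound (by fun_prop) 1 (ae_of_all _ fun ω ↦ by
        rw [Complex.norm_exp_ofReal_mul_I])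
    have i2 : Integrable (fun ω ↦ ((s * X ω : ℝ) : ℂ) * Complex.I) P :=
      ((iX.const_mul s).ofReal).mul_const _
    have i3 : Integrable (fun ω ↦ (((s * X ω) ^ 2 / 2 : ℝ) : ℂ)) P := by
      have : Integrable (fun ω ↦ (s * X ω) ^ 2 / 2) P := by
        simpa only [mul_pow] using (iX2.const_mul (s ^ 2)).div_const 2
      exact this.ofReal
    have i4 : Integrable (fun ω ↦ 1 + ((s * X ω : ℝ) : ℂ) * Complex.I) P :=
      (integrable_const _).add i2
    have i5 : Integrable (fun ω ↦
        1 + ((s * X ω : ℝ) : ℂ) * Complex.I - (((s * X ω) ^ 2 / 2 : ℝ) : ℂ)) P := i4.sub i3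
    have e2 : ((1 - v * s ^ 2 / 2 : ℝ) : ℂ)
        = ∫ ω, (1 + ((s * X ω : ℝ) : ℂ) * Complex.I - (((s * X ω) ^ 2 / 2 : ℝ) : ℂ)) ∂P := by
      rw [integral_sub i4 i3,
        integral_add (integrable_const _) i2, integral_mul_const,
        integral_complex_ofReal, integral_complex_ofReal, integral_const_mul, h0]
      simp only [mul_pow, integral_div, integral_const_mul, ← hv]
      simp
      ring
    rw [e1, e2, ← integral_sub i1 i5]
    refine (norm_integral_le_of_norm_le_const (C := |s| ^ 3 / 4) (ae_of_all _ fun ω ↦ ?_)).trans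
      (by simp)
    have hle : |s * X ω| ≤ |s| := by
      rw [abs_mul]; exact mul_le_of_le_one_right (abs_nonneg _) (hb ω)
    refine (norm_exp_mul_I_sub_taylor_le (hle.trans hs)).trans ?_
    gcongr
  have hB : ‖((1 - v * s ^ 2 / 2 : ℝ) : ℂ) - ((Real.exp (-v * s ^ 2 / 2) : ℝ) : ℂ)‖
      ≤ |s| ^ 3 / 4 := by
    rw [← Complex.ofReal_sub, Complex.norm_real, norm_sub_rev]
    have hy : ‖-v * s ^ 2 / 2‖ ≤ s ^ 2 / 2 := by
      rw [Real.norm_eq_abs, neg_mul, neg_div, abs_neg, abs_of_nonneg (by positivity)]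
      gcongr
      exact mul_le_of_le_one_left (sq_nonneg _) hv1
    have h := Real.norm_exp_sub_one_sub_id_le (x := -v * s ^ 2 / 2) (by linarith)
    have e : Real.exp (-v * s ^ 2 / 2) - (1 - v * s ^ 2 / 2)
        = Real.exp (-v * s ^ 2 / 2) - 1 - -v * s ^ 2 / 2 := by ring
    rw [e]
    refine h.trans ?_
    calc ‖-v * s ^ 2 / 2‖ ^ 2 ≤ (s ^ 2 / 2) ^ 2 := by gcongr
      _ = s ^ 4 / 4 := by ring
      _ ≤ |s| ^ 3 / 4 := by gcongr
  have := norm_sub_le_norm_sub_add_norm_sub (charFun (P.map X) s) ((1 - v * s ^ 2 / 2 : ℝ) : ℂ)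
    ((Real.exp (-v * s ^ 2 / 2) : ℝ) : ℂ)
  have h3 : 0 ≤ |s| ^ 3 := by positivity
  linarith

/-- Factors are exchanged one at a time; those left untouched have norm at most one. -/
theorem norm_prod_sub_prod_le_sum {ι : Type*} (S : Finset ι) (a b : ι → ℂ)
    (ha : ∀ i ∈ S, ‖a i‖ ≤ 1) (hb : ∀ i ∈ S, ‖b i‖ ≤ 1) :
    ‖∏ i ∈ S, a i - ∏ i ∈ S, b i‖ ≤ ∑ i ∈ S, ‖a i - b i‖ := by
  classical
  induction S using Finset.induction_on with
  | empty => simp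
  | insert i S hi ih =>
    rw [Finset.prod_insert hi, Finset.prod_insert hi, Finset.sum_insert hi]
    have hbS : ‖∏ j ∈ S, b j‖ ≤ 1 := by
      rw [norm_prod]
      exact Finset.prod_le_one (fun _ _ ↦ norm_nonneg _)
        fun j hj ↦ hb j (Finset.mem_insert_of_mem hj)
    have ih' := ih (fun j hj ↦ ha j (Finset.mem_insert_of_mem hj))
      (fun j hj ↦ hb j (Finset.mem_insert_of_mem hj))
    have e : a i * ∏ j ∈ S, a j - b i * ∏ j ∈ S, b j
        = (a i - b i) * ∏ j ∈ S, b j + a i * (∏ j ∈ S, a j - ∏ j ∈ S, b j) := by ring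
    rw [e]
    refine (norm_add_le _ _).trans (add_le_add ?_ ?_)
    · rw [norm_mul]
      exact mul_le_of_le_one_right (norm_nonneg _) hbS
    · rw [norm_mul]
      exact (mul_le_of_le_one_left (norm_nonneg _) (ha i (Finset.mem_insert_self _ _))).trans ih'

/-- If the average variance converges, then the characteristic functions of the normalised sums of
centred random variables bounded by `1` converge to a Gaussian one. -/
theorem tendsto_prod_charFun_inv_sqrt {Ω : Type*} [MeasurableSpace Ω] {P : Measure Ω}
    [IsProbabilityMeasure P] {X : ℕ → Ω → ℝ} (hX : ∀ k, Measurable (X k))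
    (hb : ∀ k ω, |X k ω| ≤ 1) (h0 : ∀ k, ∫ ω, X k ω ∂P = 0) {v : ℝ}
    (hv : Tendsto (fun m : ℕ ↦ (m : ℝ)⁻¹ * ∑ k ∈ Finset.range m, ∫ ω, X k ω ^ 2 ∂P) atTop (𝓝 v))
    (t : ℝ) :
    Tendsto (fun m : ℕ ↦ ∏ k ∈ Finset.range m, charFun (P.map (X k)) ((√m)⁻¹ * t)) atTop
      (𝓝 ((Real.exp (-v * t ^ 2 / 2) : ℝ) : ℂ)) := by
  have hsq : Tendsto (fun m : ℕ ↦ (√(m : ℝ))⁻¹) atTop (𝓝 0) :=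
    tendsto_inv_atTop_zero.comp (Real.tendsto_sqrt_atTop.comp tendsto_natCast_atTop_atTop)
  have hlim : Tendsto (fun m : ℕ ↦ ∏ k ∈ Finset.range m,
      ((Real.exp (-(∫ ω, X k ω ^ 2 ∂P) * ((√m)⁻¹ * t) ^ 2 / 2) : ℝ) : ℂ)) atTop
      (𝓝 ((Real.exp (-v * t ^ 2 / 2) : ℝ) : ℂ)) := by
    have e : ∀ m : ℕ, ∏ k ∈ Finset.range m,
        ((Real.exp (-(∫ ω, X k ω ^ 2 ∂P) * ((√m)⁻¹ * t) ^ 2 / 2) : ℝ) : ℂ)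
        = ((Real.exp (-((m : ℝ)⁻¹ * ∑ k ∈ Finset.range m, ∫ ω, X k ω ^ 2 ∂P) * t ^ 2 / 2) : ℝ)
            : ℂ) := by
      intro m
      rw [← Complex.ofReal_prod, ← Real.exp_sum]
      congr 2
      rw [mul_pow, inv_pow, Real.sq_sqrt (Nat.cast_nonneg m), Finset.mul_sum,
        ← Finset.sum_neg_distrib, Finset.sum_mul, Finset.sum_div]
      exact Finset.sum_congr rfl fun k _ ↦ by ring
    simp_rw [e]
    refine (Complex.continuous_ofReal.tendsto _).comp ((Real.continuous_exp.tendsto _).comp ?_)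
    exact ((hv.neg).mul_const _).div_const _
  -- The Gaussian products have the right limit; the error is at most `m` terms of size `|t|³
  -- m^(-3/2)`.
  refine tendsto_of_tendsto_of_dist hlim ?_
  have hz : Tendsto (fun m : ℕ ↦ |t| ^ 3 * (√(m : ℝ))⁻¹) atTop (𝓝 0) := by
    simpa using hsq.const_mul (|t| ^ 3)
  refine squeeze_zero' (Eventually.of_forall fun _ ↦ dist_nonneg) ?_ hz
  have hsmall : ∀ᶠ m : ℕ in atTop, |(√(m : ℝ))⁻¹ * t| ≤ 1 := by
    have : Tendsto (fun m : ℕ ↦ |(√(m : ℝ))⁻¹ * t|) atTop (𝓝 0) := by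
      simpa using (hsq.mul_const t).abs
    exact this.eventually_le_const zero_lt_one
  filter_upwards [hsmall, eventually_gt_atTop 0] with m hm hm0
  rw [dist_comm, dist_eq_norm]
  have : ∀ k, IsProbabilityMeasure (P.map (X k)) :=
    fun k ↦ Measure.isProbabilityMeasure_map (hX k).aemeasurable
  refine (norm_prod_sub_prod_le_sum _ _ _ (fun k _ ↦ norm_charFun_le_one _) ?_).trans ?_
  · intro k _
    rw [Complex.norm_real, Real.norm_eq_abs, Real.abs_exp, Real.exp_le_one_iff]
    have : 0 ≤ ∫ ω, X k ω ^ 2 ∂P := integral_nonneg fun ω ↦ sq_nonneg _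
    have : 0 ≤ (∫ ω, X k ω ^ 2 ∂P) * ((√m)⁻¹ * t) ^ 2 := by positivity
    linarith
  · refine (Finset.sum_le_sum fun k _ ↦
      norm_charFun_map_sub_exp_le (hX k) (hb k) (h0 k) hm).trans (le_of_eq ?_)
    have hm' : (0 : ℝ) < √m := by positivity
    have hmm : (m : ℝ) = √m ^ 2 := (Real.sq_sqrt (Nat.cast_nonneg m)).symm
    rw [Finset.sum_const, Finset.card_range, nsmul_eq_mul, abs_mul, abs_of_pos (inv_pos.2 hm')]
    nth_rewrite 1 [hmm]
    field_simp

/-! ### Averages of periodic sequences -/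

/-- The centred sum over a full period vanishes, so the partial sums are themselves periodic and
take finitely many values. -/
theorem exists_abs_sum_sub_mul_le_of_periodic {a : ℕ → ℝ} {r : ℕ} (hr : 0 < r)
    (ha : Function.Periodic a r) :
    ∃ C, ∀ m : ℕ, |∑ k ∈ Finset.range m, (a k - (1 / (r : ℝ)) * ∑ j ∈ Finset.range r, a j)| ≤ C := by
  set e := (1 / (r : ℝ)) * ∑ j ∈ Finset.range r, a j with he
  set h : ℕ → ℝ := fun m ↦ ∑ k ∈ Finset.range m, (a k - e) with hh
  have hr0 : h r = 0 := by
    have : (r : ℝ) ≠ 0 := by positivity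
    simp only [hh, Finset.sum_sub_distrib, Finset.sum_const, Finset.card_range, nsmul_eq_mul, he]
    field_simp
    simp
  have hper : Function.Periodic h r := by
    intro m
    induction m with
    | zero => simp [hr0]; simp [hh]
    | succ m ih =>
      have e1 : h (m + 1 + r) = h (m + r) + (a (m + r) - e) := by
        rw [show m + 1 + r = m + r + 1 by ring]
        exact Finset.sum_range_succ _ _
      have e2 : h (m + 1) = h m + (a m - e) := Finset.sum_range_succ _ _
      rw [e1, e2, ih, ha m]
  refine ⟨∑ j ∈ Finset.range r, |h j|, fun m ↦ ?_⟩
  change |h m| ≤ _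
  rw [← hper.map_mod_nat m]
  exact Finset.single_le_sum (f := fun j ↦ |h j|) (fun _ _ ↦ abs_nonneg _)
    (Finset.mem_range.2 (Nat.mod_lt _ hr))

theorem tendsto_inv_sqrt_mul_sum_sub_of_periodic {a : ℕ → ℝ} {r : ℕ} (hr : 0 < r)
    (ha : Function.Periodic a r) :
    Tendsto (fun m : ℕ ↦ (√m)⁻¹ *
      ∑ k ∈ Finset.range m, (a k - (1 / (r : ℝ)) * ∑ j ∈ Finset.range r, a j)) atTop (𝓝 0) := by
  obtain ⟨C, hC⟩ := exists_abs_sum_sub_mul_le_of_periodic hr ha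
  have hsq : Tendsto (fun m : ℕ ↦ (√(m : ℝ))⁻¹) atTop (𝓝 0) :=
    tendsto_inv_atTop_zero.comp (Real.tendsto_sqrt_atTop.comp tendsto_natCast_atTop_atTop)
  refine squeeze_zero_norm (fun m ↦ ?_) (by simpa using hsq.mul_const C)
  rw [norm_mul, Real.norm_eq_abs, abs_of_nonneg (by positivity : (0 : ℝ) ≤ (√m)⁻¹)]
  exact mul_le_mul_of_nonneg_left (hC m) (by positivity)

theorem tendsto_inv_mul_sum_of_periodic {a : ℕ → ℝ} {r : ℕ} (hr : 0 < r)
    (ha : Function.Periodic a r) :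
    Tendsto (fun m : ℕ ↦ (m : ℝ)⁻¹ * ∑ k ∈ Finset.range m, a k) atTop
      (𝓝 ((1 / (r : ℝ)) * ∑ j ∈ Finset.range r, a j)) := by
  have hsq : Tendsto (fun m : ℕ ↦ (√(m : ℝ))⁻¹) atTop (𝓝 0) :=
    tendsto_inv_atTop_zero.comp (Real.tendsto_sqrt_atTop.comp tendsto_natCast_atTop_atTop)
  have h := hsq.mul (tendsto_inv_sqrt_mul_sum_sub_of_periodic hr ha)
  rw [zero_mul] at h
  have h' := h.add_const ((1 / (r : ℝ)) * ∑ j ∈ Finset.range r, a j)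
  rw [zero_add] at h'
  refine h'.congr' ?_
  filter_upwards [eventually_gt_atTop 0] with m hm
  have hm' : (m : ℝ) ≠ 0 := by positivity
  rw [← mul_assoc, ← mul_inv, Real.mul_self_sqrt (Nat.cast_nonneg m), Finset.sum_sub_distrib,
    Finset.sum_const, Finset.card_range, nsmul_eq_mul, mul_sub, inv_mul_cancel_left₀ hm']
  ring

/-! ### Convergence in distribution -/

/-- **Mapping theorem**: a measurable map that is continuous on an open set carrying the limit
preserves convergence in distribution. -/
theorem MeasureTheory.TendstoInDistribution.comp_of_continuousOn_isOpen
    {Ω Ω' E F : Type*} [MeasurableSpace Ω] [MeasurableSpace Ω']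
    {P : Measure Ω} [IsProbabilityMeasure P] {P' : Measure Ω'} [IsProbabilityMeasure P']
    [TopologicalSpace E] [MeasurableSpace E] [BorelSpace E] [HasOuterApproxClosed E]
    [TopologicalSpace F] [MeasurableSpace F] [BorelSpace F] [HasOuterApproxClosed F]
    {X : ℕ → Ω → E} {Z : Ω' → E} {f : E → F} {U : Set E}
    (h : TendstoInDistribution X atTop Z (fun _ ↦ P) P') (hf : Measurable f) (hU : IsOpen U)
    (hfU : ContinuousOn f U) (hZ : ∀ᵐ ω ∂P', Z ω ∈ U) :
    TendstoInDistribution (fun n ω ↦ f (X n ω)) atTop (fun ω ↦ f (Z ω)) (fun _ ↦ P) P' where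
  forall_aemeasurable n := hf.comp_aemeasurable' (h.forall_aemeasurable n)
  aemeasurable_limit := hf.comp_aemeasurable' h.aemeasurable_limit
  tendsto := by
    refine tendsto_of_forall_isOpen_le_liminf' fun G hG ↦ ?_
    -- `f ⁻¹' G` need not be open. Intersecting with `U` makes it open, keeps its mass under the
    -- limit law and can only lower its mass along the sequence, so the portmanteau inequality
    -- survives.
    have hV : IsOpen (U ∩ f ⁻¹' G) := hfU.isOpen_inter_preimage hU hG
    have key := ProbabilityMeasure.le_liminf_measure_open_of_tendsto h.tendsto hV
    simp only [ProbabilityMeasure.coe_mk] at key ⊢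
    have hlim : P'.map (fun ω ↦ f (Z ω)) G = P'.map Z (U ∩ f ⁻¹' G) := by
      rw [Measure.map_apply_of_aemeasurable (hf.comp_aemeasurable' h.aemeasurable_limit)
        hG.measurableSet, Measure.map_apply_of_aemeasurable h.aemeasurable_limit hV.measurableSet]
      refine measure_congr ?_
      filter_upwards [hZ] with ω hω
      exact propext ⟨fun h ↦ ⟨hω, h⟩, fun h ↦ h.2⟩
    rw [hlim]
    refine key.trans (liminf_le_liminf (Eventually.of_forall fun n ↦ ?_))
    rw [Measure.map_apply_of_aemeasurable (hf.comp_aemeasurable' (h.forall_aemeasurable n))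
      hG.measurableSet, Measure.map_apply_of_aemeasurable (h.forall_aemeasurable n)
      hV.measurableSet]
    exact measure_mono fun ω hω ↦ hω.2

/-- The characteristic function of a vector of affine images of row sums of an independent array. -/
theorem charFun_map_toLp_mul_sum_add {Ω ι : Type*} [Fintype ι] [MeasurableSpace Ω] {P : Measure Ω}
    [IsProbabilityMeasure P] {X : ι × ℕ → Ω → ℝ} (hX : ∀ z, Measurable (X z))
    (hind : iIndepFun X P) (c : ℝ) (b : ι → ℝ) (m : ℕ) (t : EuclideanSpace ℝ ι) :
    charFun (P.map fun ω ↦ WithLp.toLp 2 fun i ↦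
        c * ∑ k ∈ Finset.range m, X (i, k) ω + b i) t
      = ∏ i, ((∏ k ∈ Finset.range m, charFun (P.map (X (i, k))) (c * t i)) *
          Complex.exp ((b i * t i : ℝ) * Complex.I)) := by
  -- The random part of the inner product with `t` is one sum over pairs `(i, k)`, so independence
  -- of the whole array factors it at once.
  have hsum : charFun (P.map fun ω ↦
      ∑ z ∈ Finset.univ ×ˢ Finset.range m, (c * t z.1) * X z ω) 1
      = ∏ i, ∏ k ∈ Finset.range m, charFun (P.map (X (i, k))) (c * t i) := by
    have hind' : iIndepFun (fun z ω ↦ (c * t z.1) * X z ω) P :=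
      hind.comp (fun z x ↦ (c * t z.1) * x) fun z ↦ by fun_prop
    rw [(hind'.restrict _).charFun_map_fun_finsetSum_eq_prod fun z _ ↦ by fun_prop,
      Finset.prod_apply, Finset.prod_product]
    refine Finset.prod_congr rfl fun i _ ↦ Finset.prod_congr rfl fun k _ ↦ ?_
    rw [charFun_map_mul_comp (hX _).aemeasurable, mul_one]
  rw [Finset.prod_mul_distrib, ← hsum, ← Complex.exp_sum, charFun_apply, charFun_apply_real,
    integral_map (by fun_prop) (by fun_prop), integral_map (by fun_prop) (by fun_prop),
    ← integral_mul_const]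
  refine integral_congr_ae (ae_of_all _ fun ω ↦ ?_)
  simp only
  rw [← Complex.exp_add, ← Finset.sum_mul, ← Complex.ofReal_sum, Complex.ofReal_one, one_mul,
    ← add_mul, ← Complex.ofReal_add, Finset.sum_product, ← Finset.sum_add_distrib]
  congr 3
  rw [PiLp.inner_apply]
  refine Finset.sum_congr rfl fun i _ ↦ ?_
  simp only [RCLike.inner_apply, conj_trivial, Finset.mul_sum, mul_add, mul_comm (b i)]
  congr 1
  exact Finset.sum_congr rfl fun k _ ↦ by ring

/-- A linear combination of independent standard normal random variables with a nonzero
coefficient is almost surely nonzero. -/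
theorem ae_sum_mul_ne_zero_of_gaussian {Ω ι : Type*} [Fintype ι] [MeasurableSpace Ω]
    {P : Measure Ω} [IsProbabilityMeasure P] {N : ι → Ω → ℝ} (hind : iIndepFun N P)
    (hN : ∀ i, HasLaw (N i) (gaussianReal 0 1) P) {a : ι → ℝ} {i₀ : ι} (ha : a i₀ ≠ 0) :
    ∀ᵐ ω ∂P, ∑ i, a i * N i ω ≠ 0 := by
  have hg : ∀ i, HasLaw (fun ω ↦ a i * N i ω) 
      (gaussianReal (a i * 0) (.mk (a i ^ 2) (sq_nonneg _) * 1)) P :=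
    fun i ↦ gaussianReal_const_mul (hN i) (a i)
  have hG : ∀ i, HasGaussianLaw (fun ω ↦ a i * N i ω) P := fun i ↦ (hg i).hasGaussianLaw
  have hind' : iIndepFun (fun i ω ↦ a i * N i ω) P :=
    hind.comp (fun i x ↦ a i * x) fun i ↦ by fun_prop
  have hS := (iIndepFun.hasGaussianLaw hG hind').sum
  have hvar : Var[∑ i, fun ω ↦ a i * N i ω; P] = ∑ i, a i ^ 2 := by
    rw [IndepFun.variance_sum (fun i _ ↦ (hG i).memLp_two)
      fun i _ j _ hij ↦ hind'.indepFun hij]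
    refine Finset.sum_congr rfl fun i _ ↦ ?_
    rw [(hg i).variance_eq, variance_id_gaussianReal]
    simp
  have hpos : 0 < ∑ i, a i ^ 2 :=
    Finset.sum_pos' (fun i _ ↦ sq_nonneg _) ⟨i₀, Finset.mem_univ _, by positivity⟩
  have hmap := hS.map_eq_gaussianReal
  rw [hvar] at hmap
  -- A Gaussian law of positive variance has no atoms, so its mean need not be computed.
  have : NullSingletonClass
      (gaussianReal (∫ ω, (∑ i, fun ω ↦ a i * N i ω) ω ∂P) (∑ i, a i ^ 2).toNNReal) :=
    nullSingletonClass_gaussianReal (by simpa using hpos)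
  have h0 : P.map (∑ i, fun ω ↦ a i * N i ω) {0} = 0 := by rw [hmap]; exact measure_singleton 0
  rw [Measure.map_apply_of_aemeasurable hS.aemeasurable (measurableSet_singleton 0)] at h0
  rw [ae_iff]
  convert h0 using 2
  ext ω
  simp

/-! ### The periodogram and Fisher's statistic -/

namespace BinaryPeriodicity

/-- The discrete Fourier transform at the `j`-th Fourier frequency. -/
noncomputable def fourierCoeffLin (d j : ℕ) : (Fin d → ℝ) →ₗ[ℝ] ℂ where
  toFun x := ∑ ℓ : Fin d, (x ℓ : ℂ) *
    Complex.exp (-Complex.I * ((ℓ : ℕ) + 1 : ℂ) * (fourierFreq d j : ℂ))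
  map_add' x y := by simp [add_mul, Finset.sum_add_distrib]
  map_smul' c x := by simp [Finset.mul_sum, mul_assoc]

variable {d : ℕ}

theorem periodogram_eq (x : Fin d → ℝ) (j : ℕ) :
    periodogram x j = (1 / (d : ℝ)) * ‖fourierCoeffLin d j x‖ ^ 2 := rfl

theorem periodogram_nonneg (x : Fin d → ℝ) (j : ℕ) : 0 ≤ periodogram x j := by
  rw [periodogram_eq]; positivity

theorem continuous_periodogram (j : ℕ) : Continuous fun x : Fin d → ℝ ↦ periodogram x j := by
  unfold periodogram; fun_prop

theorem periodogram_eq_zero_iff (hd : 0 < d) (x : Fin d → ℝ) (j : ℕ) :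
    periodogram x j = 0 ↔ fourierCoeffLin d j x = 0 := by
  rw [periodogram_eq]
  simp [hd.ne']

theorem periodogram_smul (c : ℝ) (x : Fin d → ℝ) (j : ℕ) :
    periodogram (c • x) j = c ^ 2 * periodogram x j := by
  rw [periodogram_eq, periodogram_eq, map_smul, norm_smul, mul_pow, Real.norm_eq_abs, sq_abs]
  ring

theorem periodogram_sub_of_mem_zeroSet (hd : 0 < d) {e : Fin d → ℝ} (he : e ∈ zeroSet d)
    (x : Fin d → ℝ) {j : ℕ} (hj : j ∈ Finset.Icc 1 (numFreq d)) :
    periodogram (x - e) j = periodogram x j := by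
  rw [periodogram_eq, periodogram_eq, map_sub, (periodogram_eq_zero_iff hd e j).1 (he j hj),
    sub_zero]

theorem isClosed_zeroSet : IsClosed (zeroSet d) := by
  have : zeroSet d = ⋂ j ∈ Finset.Icc 1 (numFreq d), {x | periodogram x j = 0} := by
    ext; simp [zeroSet]
  rw [this]
  exact isClosed_biInter fun j _ ↦ isClosed_eq (continuous_periodogram j) continuous_const

theorem sum_periodogram_eq_zero_iff (x : Fin d → ℝ) :
    ∑ m ∈ Finset.Icc 1 (numFreq d), periodogram x m = 0 ↔ x ∈ zeroSet d :=
  Finset.sum_eq_zero_iff_of_nonneg fun _ _ ↦ periodogram_nonneg _ _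

theorem one_mem_Icc_numFreq (hd : 3 ≤ d) : 1 ∈ Finset.Icc 1 (numFreq d) := by
  simp only [Finset.mem_Icc, numFreq]; omega

theorem continuous_iSup_periodogram (hd : 3 ≤ d) :
    Continuous fun x : Fin d → ℝ ↦ ⨆ j : Finset.Icc 1 (numFreq d), periodogram x (j : ℕ) := by
  have : Nonempty (Finset.Icc 1 (numFreq d)) := ⟨⟨1, one_mem_Icc_numFreq hd⟩⟩
  simp_rw [← Finset.sup'_univ_eq_ciSup]
  exact Continuous.finset_sup'_apply _ fun j _ ↦ continuous_periodogram _

theorem continuous_sum_periodogram :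
    Continuous fun x : Fin d → ℝ ↦ ∑ m ∈ Finset.Icc 1 (numFreq d), periodogram x m :=
  continuous_finsetSum _ fun m _ ↦ continuous_periodogram m

theorem measurable_fisherG (hd : 3 ≤ d) : Measurable (fisherG : (Fin d → ℝ) → ℝ) :=
  (continuous_iSup_periodogram hd).measurable.div continuous_sum_periodogram.measurable

theorem continuousOn_fisherG (hd : 3 ≤ d) :
    ContinuousOn (fisherG : (Fin d → ℝ) → ℝ) (zeroSet d)ᶜ :=
  (continuous_iSup_periodogram hd).continuousOn.div continuous_sum_periodogram.continuousOn
    fun x hx h ↦ hx ((sum_periodogram_eq_zero_iff x).1 h)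

theorem measurable_fisherF (hd : 3 ≤ d) : Measurable (fisherF : (Fin d → ℝ) → ℝ) :=
  (measurable_fisherG hd).indicator isClosed_zeroSet.isOpen_compl.measurableSet

theorem fisherF_of_notMem {x : Fin d → ℝ} (hx : x ∉ zeroSet d) : fisherF x = fisherG x :=
  Set.indicator_of_mem hx _

theorem continuousOn_fisherF (hd : 3 ≤ d) :
    ContinuousOn (fisherF : (Fin d → ℝ) → ℝ) (zeroSet d)ᶜ :=
  (continuousOn_fisherG hd).congr fun _ hx ↦ fisherF_of_notMem hx

/-- Numerator and denominator both scale by `c²`. On `A` both quotients are `0 / 0 = 0`, so no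
exclusion is needed. -/
theorem fisherG_smul {c : ℝ} (hc : c ≠ 0) (x : Fin d → ℝ) : fisherG (c • x) = fisherG x := by
  unfold fisherG
  simp_rw [periodogram_smul]
  rw [← Real.mul_iSup_of_nonneg (sq_nonneg c), ← Finset.mul_sum]
  exact mul_div_mul_left _ _ (pow_ne_zero 2 hc)

theorem smul_mem_zeroSet_iff {c : ℝ} (hc : c ≠ 0) (x : Fin d → ℝ) :
    c • x ∈ zeroSet d ↔ x ∈ zeroSet d := by
  simp [zeroSet, periodogram_smul, hc]

theorem fisherF_smul {c : ℝ} (hc : c ≠ 0) (x : Fin d → ℝ) : fisherF (c • x) = fisherF x := by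
  by_cases hx : x ∈ zeroSet d
  · have hx' := (smul_mem_zeroSet_iff hc x).2 hx
    simp [fisherF, hx, hx']
  · rw [fisherF_of_notMem hx, fisherF_of_notMem (mt (smul_mem_zeroSet_iff hc x).1 hx),
      fisherG_smul hc]

theorem fisherF_sub_of_mem_zeroSet (hd : 0 < d) {e : Fin d → ℝ} (he : e ∈ zeroSet d)
    (x : Fin d → ℝ) : fisherF (x - e) = fisherF x := by
  have hp : ∀ j ∈ Finset.Icc 1 (numFreq d), periodogram (x - e) j = periodogram x j :=
    fun j hj ↦ periodogram_sub_of_mem_zeroSet hd he x hj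
  have hmem : x - e ∈ zeroSet d ↔ x ∈ zeroSet d :=
    forall₂_congr fun j hj ↦ by rw [hp j hj]
  have hG : fisherG (x - e) = fisherG x := by
    unfold fisherG
    rw [Finset.sum_congr rfl hp, iSup_congr fun j : Finset.Icc 1 (numFreq d) ↦ hp j j.2]
  by_cases hx : x ∈ zeroSet d
  · simp [fisherF, hx, hmem.2 hx]
  · rw [fisherF_of_notMem hx, fisherF_of_notMem (mt hmem.1 hx), hG]

/-- On `A` a linear form with coefficient `1` at the first coordinate vanishes. -/
theorem sum_mul_cos_eq_zero_of_mem_zeroSet (hd : 3 ≤ d) {x : Fin d → ℝ} (hx : x ∈ zeroSet d) :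
    ∑ ℓ : Fin d, x ℓ * Real.cos ((ℓ : ℕ) * fourierFreq d 1) = 0 := by
  have h := (periodogram_eq_zero_iff (by omega) x 1).1 (hx 1 (one_mem_Icc_numFreq hd))
  -- This phase shifts the exponents from `ℓ + 1` to `ℓ`, so that the real part has coefficient `cos
  -- 0 = 1` at the first coordinate.
  have h' : Complex.exp (Complex.I * (fourierFreq d 1 : ℂ)) * fourierCoeffLin d 1 x = 0 := by
    rw [h, mul_zero]
  have e : Complex.exp (Complex.I * (fourierFreq d 1 : ℂ)) * fourierCoeffLin d 1 x
      = ∑ ℓ : Fin d, (x ℓ : ℂ) * Complex.exp ((-((ℓ : ℕ) * fourierFreq d 1) : ℝ) * Complex.I) := by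
    change _ * ∑ ℓ : Fin d, _ = _
    rw [Finset.mul_sum]
    refine Finset.sum_congr rfl fun ℓ _ ↦ ?_
    rw [mul_left_comm, ← Complex.exp_add]
    congr 2
    push_cast
    ring
  rw [e] at h'
  have h'' := congrArg Complex.re h'
  rw [Complex.re_sum, Complex.zero_re] at h''
  rw [← h'']
  refine Finset.sum_congr rfl fun ℓ _ ↦ ?_
  rw [Complex.re_ofReal_mul, Complex.exp_ofReal_mul_I_re, Real.cos_neg]

theorem ae_mul_gaussian_notMem_zeroSet {Ω : Type*} [MeasurableSpace Ω]
    {P : Measure Ω} [IsProbabilityMeasure P] (hd : 3 ≤ d) {N : Fin d → Ω → ℝ}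
    (hind : iIndepFun N P) (hN : ∀ i, HasLaw (N i) (gaussianReal 0 1) P) {a : Fin d → ℝ}
    {i₀ : Fin d} (hi₀ : (i₀ : ℕ) = 0) (ha : a i₀ ≠ 0) :
    ∀ᵐ ω ∂P, (fun i ↦ a i * N i ω) ∉ zeroSet d := by
  have := ae_sum_mul_ne_zero_of_gaussian hind hN
    (a := fun i ↦ a i * Real.cos ((i : ℕ) * fourierFreq d 1)) (i₀ := i₀) (by simpa [hi₀])
  filter_upwards [this] with ω hω hmem
  refine hω ?_
  rw [← sum_mul_cos_eq_zero_of_mem_zeroSet hd hmem]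
  exact Finset.sum_congr rfl fun i _ ↦ by ring

end BinaryPeriodicity

/-! ### Binary random variables -/

theorem integral_eq_of_binary {Ω : Type*} [MeasurableSpace Ω] {P : Measure Ω} {Y : Ω → ℝ}
    (hY : Measurable Y) (hbin : ∀ ω, Y ω = 0 ∨ Y ω = 1) :
    ∫ ω, Y ω ∂P = P.real {ω | Y ω = 1} := by
  have hm : MeasurableSet {ω | Y ω = 1} := hY (measurableSet_singleton 1)
  have : Y = {ω | Y ω = 1}.indicator fun _ ↦ (1 : ℝ) := by
    ext ω
    rcases hbin ω with h | h <;> simp [Set.indicator, h]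
  conv_lhs => rw [this]
  rw [integral_indicator hm]
  simp

theorem integral_sub_sq_of_binary {Ω : Type*} [MeasurableSpace Ω] {P : Measure Ω}
    [IsProbabilityMeasure P] {Y : Ω → ℝ} (hY : Measurable Y) (hbin : ∀ ω, Y ω = 0 ∨ Y ω = 1)
    {p : ℝ} (hp : ∫ ω, Y ω ∂P = p) : ∫ ω, (Y ω - p) ^ 2 ∂P = p * (1 - p) := by
  have iY : Integrable Y P := Integrable.of_bound hY.aestronglyMeasurable 1
    (ae_of_all _ fun ω ↦ by rcases hbin ω with h | h <;> simp [h])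
  -- Since `Y² = Y`, the square is affine in `Y`.
  have e : ∀ ω, (Y ω - p) ^ 2 = (1 - 2 * p) * Y ω + p ^ 2 := fun ω ↦ by
    rcases hbin ω with h | h <;> rw [h] <;> ring
  simp_rw [e]
  rw [integral_add (iY.const_mul _) (integrable_const _), integral_const_mul, hp]
  simp
  ring

theorem variance_of_binary {Ω : Type*} [MeasurableSpace Ω] {P : Measure Ω}
    [IsProbabilityMeasure P] {Y : Ω → ℝ} (hY : Measurable Y) (hbin : ∀ ω, Y ω = 0 ∨ Y ω = 1)
    {p : ℝ} (hp : ∫ ω, Y ω ∂P = p) : Var[Y; P] = p * (1 - p) := by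
  rw [variance_eq_integral hY.aemeasurable, hp, integral_sub_sq_of_binary hY hbin hp]

theorem charFun_map_toLp_sqrt_mul_gaussian {Ω ι : Type*} [Fintype ι] [MeasurableSpace Ω]
    {P : Measure Ω} [IsProbabilityMeasure P] {N : ι → Ω → ℝ} (hind : iIndepFun N P)
    (hN : ∀ i, HasLaw (N i) (gaussianReal 0 1) P) {v : ι → ℝ} (hv : ∀ i, 0 ≤ v i)
    (t : EuclideanSpace ℝ ι) :
    charFun (P.map fun ω ↦ WithLp.toLp 2 fun i ↦ √(v i) * N i ω) t
      = ∏ i, ((Real.exp (-v i * t i ^ 2 / 2) : ℝ) : ℂ) := by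
  have hind' : iIndepFun (fun i ω ↦ √(v i) * N i ω) P :=
    hind.comp (fun i x ↦ √(v i) * x) fun i ↦ by fun_prop
  rw [(iIndepFun_iff_charFun_pi fun i ↦ (hN i).aemeasurable.const_mul _).1 hind' t]
  refine Finset.prod_congr rfl fun i _ ↦ ?_
  rw [charFun_map_mul_comp (hN i).aemeasurable, (hN i).map_eq, charFun_gaussianReal]
  push_cast
  congr 1
  have : ((√(v i) : ℝ) : ℂ) ^ 2 = v i := by rw [← Complex.ofReal_pow, Real.sq_sqrt (hv i)]
  simp only [mul_pow, this]
  simp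
  ring

/-! ### Joint central limit theorem for the block means -/

namespace BinaryPeriodicity

theorem IsPeriodLength.periodic_arith {p : ℕ → ℝ} {r : ℕ} (hr : IsPeriodLength p r) (i d : ℕ) :
    Function.Periodic (fun k ↦ p (i + k * d)) r := fun k ↦ by
  change p (i + (k + r) * d) = p (i + k * d)
  rw [hr.1.2 (i + k * d) d]
  congr 1
  ring

/-- Residue and quotient mod `d` determine the pair. Distinct pairs thus pick distinct `Y`, and the
array indexed by `Fin d × ℕ` inherits independence. -/
theorem injective_val_add_mul (d : ℕ) :
    Function.Injective fun z : Fin d × ℕ ↦ (z.1 : ℕ) + z.2 * d := by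
  rintro ⟨i, k⟩ ⟨j, l⟩ h
  have hd : 0 < d := i.pos
  simp only at h
  have h1 : (i : ℕ) = j := by
    simpa [Nat.mod_eq_of_lt] using congrArg (· % d) h
  have h2 : k = l := by
    rw [h1] at h
    exact Nat.eq_of_mul_eq_mul_right hd (by omega)
  exact Prod.ext (Fin.ext h1) h2

/-- Splits the rescaled error into a centred random sum and a deterministic bias. -/
theorem sqrt_smul_blockMean_sub {Ω : Type*} {Y : ℕ → Ω → ℝ} {d : ℕ} (p : ℕ → ℝ)
    (e : Fin d → ℝ) (n : ℕ) (ω : Ω) :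
    √((n / d : ℕ) : ℝ) • (blockMean Y d n ω - e) = fun i : Fin d ↦
      (√((n / d : ℕ) : ℝ))⁻¹ * ∑ k ∈ Finset.range (n / d),
        (Y ((i : ℕ) + k * d) ω - p ((i : ℕ) + k * d)) +
      (√((n / d : ℕ) : ℝ))⁻¹ * ∑ k ∈ Finset.range (n / d), (p ((i : ℕ) + k * d) - e i) := by
  ext i
  simp only [Pi.smul_apply, Pi.sub_apply, smul_eq_mul, blockMean]
  generalize n / d = m
  rw [← mul_add, ← Finset.sum_add_distrib]
  simp only [sub_add_sub_cancel, Finset.sum_sub_distrib, Finset.sum_const, Finset.card_range,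
    nsmul_eq_mul]
  rcases Nat.eq_zero_or_pos m with rfl | hm
  · simp
  · have hm' : (0 : ℝ) < m := by positivity
    have hs : (0 : ℝ) < √m := by positivity
    have hq : (m : ℝ) = √m ^ 2 := (Real.sq_sqrt hm'.le).symm
    field_simp
    rw [← hq]

theorem fisherF_blockMean_eq {Ω : Type*} {Y : ℕ → Ω → ℝ} {d : ℕ} (hd : 0 < d)
    {e : Fin d → ℝ} (he : e ∈ zeroSet d) (n : ℕ) (ω : Ω) :
    fisherF (√((n / d : ℕ) : ℝ) • (blockMean Y d n ω - e)) = fisherF (blockMean Y d n ω) := by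
  -- For `n < d` the scaling factor is `0`, but the block mean is then `0` as well.
  rcases Nat.eq_zero_or_pos (n / d) with h | h
  · have : blockMean Y d n ω = 0 := by ext i; simp [blockMean, h]
    simp [this, h]
  · rw [fisherF_smul (by positivity), fisherF_sub_of_mem_zeroSet hd he]

variable {Ω Ω' : Type*} [MeasurableSpace Ω] [MeasurableSpace Ω']
  {P : Measure Ω} [IsProbabilityMeasure P] {P' : Measure Ω'} [IsProbabilityMeasure P']
  {Y : ℕ → Ω → ℝ} {p : ℕ → ℝ} {r d : ℕ}

/-- The rescaled block means converge jointly to a centred Gaussian vector with independent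
coordinates. -/
theorem tendstoInDistribution_sqrt_smul_blockMean_sub
    (hYmeas : ∀ ℓ, Measurable (Y ℓ)) (hYbin : ∀ ℓ ω, Y ℓ ω = 0 ∨ Y ℓ ω = 1)
    (hYindep : iIndepFun Y P) (hp : ∀ ℓ, P.real {ω | Y ℓ ω = 1} = p ℓ)
    (hr : IsPeriodLength p r) (hd : 0 < d)
    {N : Fin d → Ω' → ℝ} (hNindep : iIndepFun N P')
    (hNlaw : ∀ i, HasLaw (N i) (gaussianReal 0 1) P') :
    TendstoInDistribution
      (fun (n : ℕ) ω ↦ √((n / d : ℕ) : ℝ) • (blockMean Y d n ω - limitMean p r d)) atTop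
      (fun ω i ↦ √(limitVar P Y r d i) * N i ω) (fun _ ↦ P) P' := by
  have hr0 : 0 < r := hr.1.1
  have hmean : ∀ ℓ, ∫ ω, Y ℓ ω ∂P = p ℓ := fun ℓ ↦ by
    rw [integral_eq_of_binary (hYmeas ℓ) (hYbin ℓ), hp]
  have hp01 : ∀ ℓ, 0 ≤ p ℓ ∧ p ℓ ≤ 1 := fun ℓ ↦ by
    rw [← hp]; exact ⟨measureReal_nonneg, measureReal_le_one⟩
  set X : Fin d × ℕ → Ω → ℝ :=
    fun z ω ↦ Y ((z.1 : ℕ) + z.2 * d) ω - p ((z.1 : ℕ) + z.2 * d) with hXdef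
  have hX : ∀ z, Measurable (X z) := fun z ↦ (hYmeas _).sub_const _
  have hXind : iIndepFun X P :=
    (hYindep.precomp (injective_val_add_mul d)).comp
      (fun z x ↦ x - p ((z.1 : ℕ) + z.2 * d)) fun z ↦ by fun_prop
  have hXb : ∀ z ω, |X z ω| ≤ 1 := fun z ω ↦ by
    have := hp01 ((z.1 : ℕ) + z.2 * d)
    rw [abs_le]
    simp only [hXdef]
    rcases hYbin ((z.1 : ℕ) + z.2 * d) ω with h | h <;> rw [h] <;> constructor <;> linarith
  have hX0 : ∀ z, ∫ ω, X z ω ∂P = 0 := fun z ↦ by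
    have iY : Integrable (Y ((z.1 : ℕ) + z.2 * d)) P :=
      Integrable.of_bound (hYmeas _).aestronglyMeasurable 1
        (ae_of_all _ fun ω ↦ by rcases hYbin ((z.1 : ℕ) + z.2 * d) ω with h | h <;> simp [h])
    simp only [hXdef]
    rw [integral_sub iY (integrable_const _), hmean]
    simp
  have hvar : ∀ ℓ, Var[Y ℓ; P] = p ℓ * (1 - p ℓ) := fun ℓ ↦
    variance_of_binary (hYmeas ℓ) (hYbin ℓ) (hmean ℓ)
  have hX2 : ∀ z, ∫ ω, X z ω ^ 2 ∂P = Var[Y ((z.1 : ℕ) + z.2 * d); P] := fun z ↦ by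
    rw [hvar]
    exact integral_sub_sq_of_binary (hYmeas _) (hYbin _) (hmean _)
  have hdiv : Tendsto (fun n : ℕ ↦ n / d) atTop atTop := Nat.tendsto_div_const_atTop hd.ne'
  have hv0 : ∀ i, 0 ≤ limitVar P Y r d i := fun i ↦
    mul_nonneg (by positivity) (Finset.sum_nonneg fun _ _ ↦ variance_nonneg _ _)
  have hmeasN : AEMeasurable
      (fun ω ↦ WithLp.toLp 2 fun i ↦ √(limitVar P Y r d i) * N i ω) P' := by
    have := fun i ↦ (hNlaw i).aemeasurable
    fun_prop
  set b : ℕ → Fin d → ℝ := fun m i ↦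
    (√(m : ℝ))⁻¹ * ∑ k ∈ Finset.range m, (p ((i : ℕ) + k * d) - limitMean p r d i) with hb
  -- The limit is first taken in Euclidean space, whose inner product defines the characteristic
  -- function, and then carried back by the continuous map `WithLp.ofLp`.
  have hE : TendstoInDistribution
      (fun (n : ℕ) ω ↦ WithLp.toLp 2 fun i ↦
        (√((n / d : ℕ) : ℝ))⁻¹ * ∑ k ∈ Finset.range (n / d), X (i, k) ω + b (n / d) i) atTop
      (fun ω ↦ WithLp.toLp 2 fun i ↦ √(limitVar P Y r d i) * N i ω) (fun _ ↦ P) P' := by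
    refine ⟨fun n ↦ by fun_prop, hmeasN, ?_⟩
    refine ProbabilityMeasure.tendsto_iff_tendsto_charFun.2 fun t ↦ ?_
    simp only [ProbabilityMeasure.coe_mk]
    rw [charFun_map_toLp_sqrt_mul_gaussian hNindep hNlaw hv0]
    simp_rw [charFun_map_toLp_mul_sum_add hX hXind]
    refine tendsto_finsetProd _ fun i _ ↦ ?_
    have h1 : Tendsto (fun m : ℕ ↦
        ∏ k ∈ Finset.range m, charFun (P.map (X (i, k))) ((√(m : ℝ))⁻¹ * t i)) atTop
        (𝓝 ((Real.exp (-limitVar P Y r d i * t i ^ 2 / 2) : ℝ) : ℂ)) := by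
      refine tendsto_prod_charFun_inv_sqrt (fun k ↦ hX (i, k)) (fun k ↦ hXb (i, k))
        (fun k ↦ hX0 (i, k)) ?_ (t i)
      simp_rw [hX2]
      refine tendsto_inv_mul_sum_of_periodic
        (a := fun k ↦ Var[Y ((i : ℕ) + k * d); P]) hr0 fun k ↦ ?_
      simp only [hvar]
      have hk : p ((i : ℕ) + (k + r) * d) = p ((i : ℕ) + k * d) := hr.periodic_arith i d k
      rw [hk]
    have h2 : Tendsto (fun m : ℕ ↦ Complex.exp ((b m i * t i : ℝ) * Complex.I)) atTop (𝓝 1) := by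
      have hb0 : Tendsto (fun m ↦ b m i) atTop (𝓝 0) :=
        tendsto_inv_sqrt_mul_sum_sub_of_periodic hr0 (hr.periodic_arith i d)
      have hc : Continuous fun x : ℝ ↦ Complex.exp ((x * t i : ℝ) * Complex.I) := by fun_prop
      have := (hc.tendsto 0).comp hb0
      simpa [Function.comp_def] using this
    simpa [Function.comp_def] using (h1.mul h2).comp hdiv
  have := hE.continuous_comp (g := WithLp.ofLp) (PiLp.continuous_ofLp 2 _)
  refine this.congr (fun n ↦ ae_of_all _ fun ω ↦ ?_) (ae_of_all _ fun ω ↦ rfl)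
  exact (sqrt_smul_blockMean_sub p (limitMean p r d) n ω).symm

theorem limitVar_pos (hYmeas : ∀ ℓ, Measurable (Y ℓ)) (hYbin : ∀ ℓ ω, Y ℓ ω = 0 ∨ Y ℓ ω = 1)
    (hp : ∀ ℓ, P.real {ω | Y ℓ ω = 1} = p ℓ) (hp01 : ∀ ℓ, p ℓ ∈ Set.Ioo (0 : ℝ) 1)
    (hr : 0 < r) (i : Fin d) : 0 < limitVar P Y r d i := by
  refine mul_pos (by positivity) (Finset.sum_pos (fun j _ ↦ ?_) ⟨0, Finset.mem_range.2 hr⟩)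
  rw [variance_of_binary (hYmeas _) (hYbin _)
    ((integral_eq_of_binary (hYmeas _) (hYbin _)).trans (hp _))]
  exact mul_pos (hp01 _).1 (sub_pos.2 (hp01 _).2)

end BinaryPeriodicity

theorem mainTheorem2
    {Ω Ω' : Type*} [MeasurableSpace Ω] [MeasurableSpace Ω']
    (P : Measure Ω) [IsProbabilityMeasure P] (P' : Measure Ω') [IsProbabilityMeasure P']
    -- the binary time series
    (Y : ℕ → Ω → ℝ) (p : ℕ → ℝ) (r d : ℕ)
    (hYmeas : ∀ ℓ, Measurable (Y ℓ))
    (hYbin : ∀ ℓ ω, Y ℓ ω = 0 ∨ Y ℓ ω = 1)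
    (hYindep : iIndepFun Y P)
    (hp : ∀ ℓ, P.real {ω | Y ℓ ω = 1} = p ℓ)
    (hp01 : ∀ ℓ, p ℓ ∈ Set.Ioo (0 : ℝ) 1)
    (hr : IsPeriodLength p r)
    (hd : 3 ≤ d)
    -- the vector of limits lies in `A`
    (he : limitMean p r d ∈ zeroSet d)
    -- i.i.d. standard normal random variables
    (N : Fin d → Ω' → ℝ)
    (hNindep : iIndepFun N P')
    (hNlaw : ∀ i, HasLaw (N i) (gaussianReal 0 1) P') :
    -- both limit vectors are almost surely in the domain of `g`
    (∀ᵐ ω ∂P', (fun i => √(limitVar P Y r d i) * N i ω) ∉ zeroSet d) ∧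
    (∀ᵐ ω ∂P', (fun i => √(limitVar P Y r d i) / √(limitVar P Y r d ⟨0, by omega⟩) * N i ω)
      ∉ zeroSet d) ∧
    TendstoInDistribution
      (fun (n : ℕ) ω => fisherF (blockMean Y d n ω)) atTop
      (fun ω => fisherG (fun i => √(limitVar P Y r d i) * N i ω))
      (fun _ => P) P' ∧
    IdentDistrib
      (fun ω => fisherG (fun i => √(limitVar P Y r d i) * N i ω))
      (fun ω => fisherG
        (fun i => √(limitVar P Y r d i) / √(limitVar P Y r d ⟨0, by omega⟩) * N i ω))
      P' P' := by
  have hv : ∀ i, 0 < limitVar P Y r d i := limitVar_pos hYmeas hYbin hp hp01 hr.1.1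
  have hs : ∀ i, √(limitVar P Y r d i) ≠ 0 := fun i ↦ (Real.sqrt_pos.2 (hv i)).ne'
  have hA : ∀ᵐ ω ∂P', (fun i => √(limitVar P Y r d i) * N i ω) ∉ zeroSet d :=
    ae_mul_gaussian_notMem_zeroSet hd hNindep hNlaw (i₀ := ⟨0, by omega⟩) rfl (hs _)
  refine ⟨hA, ae_mul_gaussian_notMem_zeroSet hd hNindep hNlaw (i₀ := ⟨0, by omega⟩) rfl
    (div_ne_zero (hs _) (hs _)), ?_, ?_⟩
  · have h := tendstoInDistribution_sqrt_smul_blockMean_sub hYmeas hYbin hYindep hp hr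
      (by omega) hNindep hNlaw
    refine (h.comp_of_continuousOn_isOpen (measurable_fisherF hd) isClosed_zeroSet.isOpen_compl
      (continuousOn_fisherF hd) hA).congr
        (fun n ↦ ae_of_all _ fun ω ↦ fisherF_blockMean_eq (by omega) he n ω) ?_
    filter_upwards [hA] with ω hω using fisherF_of_notMem hω
  · have hm : AEMeasurable (fun ω => fisherG (fun i => √(limitVar P Y r d i) * N i ω)) P' := by
      refine (measurable_fisherG hd).comp_aemeasurable' ?_
      exact aemeasurable_pi_lambda _ fun i ↦ (hNlaw i).aemeasurable.const_mul _
    -- The two statistics agree at every `ω`, by scaling with `(√v_1)⁻¹`.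
    convert IdentDistrib.refl hm using 2 with ω
    rw [← fisherG_smul (inv_ne_zero (hs ⟨0, by omega⟩)) fun i => √(limitVar P Y r d i) * N i ω]
    congr 1
    ext i
    simp only [Pi.smul_apply, smul_eq_mul]
    ring
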